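/- Let $A\in\mathbb R^{m\times n}$ with spectral norm $\|A\|$, and let $f:\mathbb R^n\to(-\infty,+\infty]$ and $g:\mathbb R^m\to(-\infty,+\infty]$ be closed proper convex functions such that the problem $$\min\{f(x)+g(z): Ax=z\}\tag{P}$$ has a solution (a feasible point with finite, minimal objective value). Assume that either $f$ and $g$ are finite everywhere, or the Lagrangian $L(x,z,y)=f(x)+g(z)+\langle y,Ax-z\rangle$ has a saddle point (minimum in $(x,z)$, maximum in $y$). For $\gamma\in(0,2)$ and $\lambda>0$ consider the relaxed predictor corrector proximal multiplier method (G-PCPM-I) $$\begin{aligned} p^{k+1}&=y^k+\lambda(Ax^k-z^k),\\ x^{k+1}&=\arg\min_x\Big\{f(x)+\langle p^{k+1},Ax\rangle+\tfrac1{2\lambda}\|x-x^k\|^2\Big\},\\ z^{k+1}&=\arg\min_z\Big\{g(z)-\langle p^{k+1},z\rangle+\tfrac1{2\lambda}\|z-z^k\|^2\Big\},\\ y^{k+1}&=y^k+\gamma\lambda(Ax^{k+1}-z^{k+1}). \end{aligned}$$ If $$\lambda<\frac1{\sqrt{\frac{2+\gamma}{4}\,(\|A\|^2+1)}},$$ then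 the method converges globally: from every starting point $(x^0,z^0,y^0)\in\mathbb R^n\times\mathbb R^m\times\mathbb R^m$ it generates exactly one sequence $(x^k,z^k,y^k)$, and this sequence converges to some $(x^*,z^*,y^*)$ such that $(x^*,z^*)$ is a solution of (P) and $(x^*,z^*,y^*)$ is a saddle point of $L$. In particular, the original method PCPM, in which $y^{k+1}=y^k+\lambda(Ax^{k+1}-z^{k+1})$ (that is, $\gamma=1$), converges globally in the same sense whenever $$0<\lambda<\frac1{\sqrt{\frac34(\|A\|^2+1)}}.$$ -/

import Mathlib

open Filter Topology

noncomputable section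

namespace PCPM

section Functions

variable {E : Type*} [NormedAddCommGroup E] [InnerProductSpace ℝ E]

/-- A closed proper convex function with values in `(-∞, +∞]`: lower semicontinuous, never `-∞`,
not identically `+∞`, with convex epigraph. -/
structure IsClosedProperConvex (f : E → EReal) : Prop where
  lsc : LowerSemicontinuous f
  ne_bot : ∀ x, f x ≠ ⊥
  exists_ne_top : ∃ x, f x ≠ ⊤
  convex_epigraph : Convex ℝ {q : E × ℝ | f q.1 ≤ (q.2 : EReal)}

end Functions

section Problem

variable {E F : Type*} [NormedAddCommGroup E] [InnerProductSpace ℝ E]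
  [NormedAddCommGroup F] [InnerProductSpace ℝ F]

/-- `(x, z)` is a solution of `min {f(x) + g(z) : A x = z}`: it is feasible, has finite objective
value, and its objective value is minimal among all feasible points. -/
structure IsSolution (A : E →L[ℝ] F) (f : E → EReal) (g : F → EReal) (x : E) (z : F) : Prop where
  feasible : A x = z
  finite : f x + g z ≠ ⊤
  minimal : ∀ (x' : E) (z' : F), A x' = z' → f x + g z ≤ f x' + g z'

/-- The Lagrangian `L(x, z, y) = f(x) + g(z) + ⟨y, A x - z⟩`. -/
def lagrangian (A : E →L[ℝ] F) (f : E → EReal) (g : F → EReal) (x : E) (z y : F) : EReal :=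
  f x + g z + ((inner ℝ y (A x - z) : ℝ) : EReal)

/-- `(x, z, y)` is a saddle point of the Lagrangian (minimum in `(x, z)`, maximum in `y`). -/
def IsSaddlePoint (A : E →L[ℝ] F) (f : E → EReal) (g : F → EReal) (x : E) (z y : F) : Prop :=
  (∀ y' : F, lagrangian A f g x z y' ≤ lagrangian A f g x z y) ∧
    ∀ (x' : E) (z' : F), lagrangian A f g x z y ≤ lagrangian A f g x' z' y

/-- The predictor `p^{k+1} = y^k + lam (A x^k - z^k)`. -/
def predictor (A : E →L[ℝ] F) (lam : ℝ) (w : E × F × F) : F :=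
  w.2.2 + lam • (A w.1 - w.2.1)

/-- The function minimized in the `x`-step:
`f(x) + ⟨p, A x⟩ + (1 / (2 lam)) ‖x - x^k‖²`. -/
def xObjective (A : E →L[ℝ] F) (f : E → EReal) (lam : ℝ) (p : F) (xk x : E) : EReal :=
  f x + ((inner ℝ p (A x) + 1 / (2 * lam) * ‖x - xk‖ ^ 2 : ℝ) : EReal)

/-- The function minimized in the `z`-step:
`g(z) - ⟨p, z⟩ + (1 / (2 lam)) ‖z - z^k‖²`. -/
def zObjective (g : F → EReal) (lam : ℝ) (p : F) (zk z : F) : EReal :=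
  g z + ((-inner ℝ p z + 1 / (2 * lam) * ‖z - zk‖ ^ 2 : ℝ) : EReal)

/-- One iteration `(x^k, z^k, y^k) ↦ (x^{k+1}, z^{k+1}, y^{k+1})` of the original predictor
corrector proximal multiplier method. -/
structure PCPMStep (A : E →L[ℝ] F) (f : E → EReal) (g : F → EReal) (lam : ℝ)
    (w w' : E × F × F) : Prop where
  x_step : ∀ x, xObjective A f lam (predictor A lam w) w.1 w'.1 ≤
    xObjective A f lam (predictor A lam w) w.1 x
  z_step : ∀ z, zObjective g lam (predictor A lam w) w.2.1 w'.2.1 ≤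
    zObjective g lam (predictor A lam w) w.2.1 z
  y_step : w'.2.2 = w.2.2 + lam • (A w'.1 - w'.2.1)

/-- One iteration of the relaxed method: as `PCPMStep`, but with the dual update
`y^{k+1} = y^k + γ lam (A x^{k+1} - z^{k+1})`. -/
structure GPCPMStep (A : E →L[ℝ] F) (f : E → EReal) (g : F → EReal) (γ lam : ℝ)
    (w w' : E × F × F) : Prop where
  x_step : ∀ x, xObjective A f lam (predictor A lam w) w.1 w'.1 ≤
    xObjective A f lam (predictor A lam w) w.1 x
  z_step : ∀ z, zObjective g lam (predictor A lam w) w.2.1 w'.2.1 ≤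
    zObjective g lam (predictor A lam w) w.2.1 z
  y_step : w'.2.2 = w.2.2 + (γ * lam) • (A w'.1 - w'.2.1)

/-- Global convergence of the iteration `step` for `min {f(x) + g(z) : A x = z}`: every starting
point generates exactly one sequence `(x^k, z^k, y^k)`, and every generated sequence converges to
some `(x, z, y)` such that `(x, z)` is a solution and `(x, z, y)` is a saddle point of the
Lagrangian. -/
def ConvergesGlobally (A : E →L[ℝ] F) (f : E → EReal) (g : F → EReal)
    (step : E × F × F → E × F × F → Prop) : Prop :=
  (∀ w₀ : E × F × F, ∃! w : ℕ → E × F × F, w 0 = w₀ ∧ ∀ k, step (w k) (w (k + 1))) ∧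
    ∀ w : ℕ → E × F × F, (∀ k, step (w k) (w (k + 1))) →
      ∃ (x : E) (z y : F), Tendsto w atTop (𝓝 (x, z, y)) ∧
        IsSolution A f g x z ∧ IsSaddlePoint A f g x z y

end Problem

end PCPM

end

/-!
The pair `u = (x, z)` solves the saddle point problem with multiplier `y` exactly when `B u = 0` and
`-B* y ∈ T u`, where `B (x, z) = A x - z` satisfies `‖B‖² ≤ ‖A‖² + 1` and `T = ∂f × ∂g` is monotone
with closed graph (`isSaddlePoint_iff`). By Fermat's rule
(`IsClosedProperConvex.isMin_proxObjective_iff`) a step of the method is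
`-B* (y + lam B u) - (u⁺ - u) / lam ∈ T u⁺`, `y⁺ = y + γ lam B u⁺`; proximal steps exist and are
unique (`existsUnique_gpcpmStep`).

Put `d = u⁺ - u` and let `(u*, y*)` be a zero. Monotonicity at `u⁺` and `u*` gives the usual energy
estimate for `‖u - u*‖² + ‖y - y*‖² / γ - lam² ‖B u‖²`, with decrease
`‖d‖² - lam² ‖B d‖² + (2 - γ) lam² ‖B u⁺‖²` (`energy_le`). This suffices if `lam ‖B‖ < 1`, but the
admissible step sizes go up to `lam² ‖B‖² < s < 4 / (2 + γ)`, beyond `1`. Monotonicity at two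
consecutive iterates shows that `γ lam² ‖B u‖² + ‖d‖² - (2 / s - 1) lam² ‖B d‖²` decreases by at
least `(4 / s - (2 + γ)) lam² ‖B d‖²` in each step (`residual_le`). A large multiple of the latter
added to the former is a Lyapunov function that dominates `‖u - u*‖² + ‖y - y*‖² / γ` and decreases
by at least `‖d‖² + (2 - γ) lam² ‖B u⁺‖²` (`IsProximalSequence.lyapunov_succ_le`, `le_lyapunov`).
Hence the iterates are bounded, increments and residuals vanish, cluster points are zeros, and the
Lyapunov function of a cluster point forces convergence to it (`IsProximalSequence.tendsto`).

If `f` and `g` are real-valued, a saddle point exists because a solution has a multiplier, by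
separation of a point from an open convex set (`IsSolution.exists_isSaddlePoint`).
-/

namespace PCPM

/-! ### Subgradients and proximal steps -/

section Subgradients

variable {E : Type*} [NormedAddCommGroup E] [InnerProductSpace ℝ E]

/-- `ξ` is a subgradient of `f` at `x`. The value of `f` at `x` is required to be real, so that no
point outside the domain has subgradients. -/
def HasSubgradientAt (f : E → EReal) (x ξ : E) : Prop :=
  ∃ a : ℝ, f x = a ∧ ∀ x', ((a + inner ℝ ξ (x' - x) : ℝ) : EReal) ≤ f x'

theorem HasSubgradientAt.inner_sub_nonneg {f : E → EReal} {x ξ x' ξ' : E}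
    (h : HasSubgradientAt f x ξ) (h' : HasSubgradientAt f x' ξ') :
    0 ≤ inner ℝ (ξ - ξ') (x - x') := by
  obtain ⟨a, ha, h⟩ := h
  obtain ⟨b, hb, h'⟩ := h'
  have h1 := h x'
  have h2 := h' x
  rw [hb, EReal.coe_le_coe_iff] at h1
  rw [ha, EReal.coe_le_coe_iff] at h2
  have e : inner ℝ ξ (x' - x) = -inner ℝ ξ (x - x') := by rw [← inner_neg_right, neg_sub]
  rw [inner_sub_left]
  linarith

theorem IsClosedProperConvex.exists_coe_eq {f : E → EReal} (hf : IsClosedProperConvex f) {x : E}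
    (hx : f x ≠ ⊤) : ∃ a : ℝ, f x = a :=
  ⟨(f x).toReal, (EReal.coe_toReal hx (hf.ne_bot x)).symm⟩

/-- The graph of the subdifferential is closed. -/
theorem IsClosedProperConvex.hasSubgradientAt_of_tendsto {f : E → EReal}
    (hf : IsClosedProperConvex f) {x ξ : ℕ → E} {x₀ ξ₀ : E}
    (h : ∀ k, HasSubgradientAt f (x k) (ξ k)) (hx : Tendsto x atTop (𝓝 x₀))
    (hξ : Tendsto ξ atTop (𝓝 ξ₀)) : HasSubgradientAt f x₀ ξ₀ := by
  have key : ∀ x' (b : ℝ), f x' = b → f x₀ ≤ ((b - inner ℝ ξ₀ (x' - x₀) : ℝ) : EReal) := by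
    intro x' b hb
    refine le_of_forall_lt fun t ht => ?_
    obtain ⟨t', htt', ht'⟩ := exists_between ht
    refine htt'.trans_le ?_
    have hlim : Tendsto (fun k => ((b - inner ℝ (ξ k) (x' - x k) : ℝ) : EReal)) atTop
        (𝓝 ((b - inner ℝ ξ₀ (x' - x₀) : ℝ) : EReal)) :=
      (continuous_coe_real_ereal.tendsto _).comp
        ((hξ.inner (hx.const_sub x')).const_sub b)
    refine ge_of_tendsto hlim ?_
    filter_upwards [hx.eventually (hf.lsc x₀ t' ht')] with k hk
    obtain ⟨a, ha, hsub⟩ := h k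
    have := hsub x'
    rw [hb, EReal.coe_le_coe_iff] at this
    rw [ha] at hk
    refine hk.le.trans (EReal.coe_le_coe_iff.2 ?_)
    linarith
  obtain ⟨x', hx'⟩ := hf.exists_ne_top
  obtain ⟨b, hb⟩ := hf.exists_coe_eq hx'
  obtain ⟨a, ha⟩ := hf.exists_coe_eq (ne_top_of_le_ne_top (EReal.coe_ne_top _) (key x' b hb))
  refine ⟨a, ha, fun x'' => ?_⟩
  by_cases h'' : f x'' = ⊤
  · simp [h'']
  obtain ⟨c, hc⟩ := hf.exists_coe_eq h''
  have := key x'' c hc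
  rw [ha, EReal.coe_le_coe_iff] at this
  rw [hc, EReal.coe_le_coe_iff]
  linarith

theorem IsClosedProperConvex.le_segment {f : E → EReal} (hf : IsClosedProperConvex f) {x x' : E}
    {a b t : ℝ} (ha : f x ≤ a) (hb : f x' ≤ b) (ht0 : 0 ≤ t) (ht1 : t ≤ 1) :
    f (x + t • (x' - x)) ≤ ((a + t * (b - a) : ℝ) : EReal) := by
  have := hf.convex_epigraph (x := (x, a)) ha (y := (x', b)) hb (sub_nonneg.2 ht1) ht0 (by ring)
  have e1 : (1 - t) • x + t • x' = x + t • (x' - x) := by module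
  have e2 : (1 - t) * a + t * b = a + t * (b - a) := by ring
  simpa [e1, e2] using this

/-- The objective `f(x) + ⟨v, x⟩ + c ‖x - x₀‖²` of a linearly perturbed proximal step. Both
minimizations of the method have this form, with `c = 1 / (2 lam)`. -/
noncomputable def proxObjective (f : E → EReal) (v : E) (c : ℝ) (x₀ x : E) : EReal :=
  f x + ((inner ℝ v x + c * ‖x - x₀‖ ^ 2 : ℝ) : EReal)

theorem norm_add_smul_sub_sq (x x₀ w : E) (t : ℝ) :
    ‖x + t • w - x₀‖ ^ 2 = ‖x - x₀‖ ^ 2 + t * (2 * inner ℝ (x - x₀) w) + t ^ 2 * ‖w‖ ^ 2 := by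
  rw [show x + t • w - x₀ = (x - x₀) + t • w by abel, norm_add_sq_real, real_inner_smul_right,
    norm_smul, mul_pow, Real.norm_eq_abs, sq_abs]
  ring

/-- Fermat's rule for a proximal step. -/
theorem IsClosedProperConvex.isMin_proxObjective_iff {f : E → EReal} (hf : IsClosedProperConvex f)
    (v : E) {c : ℝ} (hc : 0 ≤ c) (x₀ x : E) :
    (∀ x', proxObjective f v c x₀ x ≤ proxObjective f v c x₀ x') ↔
      HasSubgradientAt f x (-v - (2 * c) • (x - x₀)) := by
  constructor
  · intro h
    obtain ⟨x₁, hx₁⟩ := hf.exists_ne_top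
    obtain ⟨b₁, hb₁⟩ := hf.exists_coe_eq hx₁
    have hx : f x ≠ ⊤ := fun hx => by
      have := h x₁
      rw [proxObjective, proxObjective, hx, hb₁, EReal.top_add_coe, ← EReal.coe_add, top_le_iff]
        at this
      exact EReal.coe_ne_top _ this
    obtain ⟨a, ha⟩ := hf.exists_coe_eq hx
    refine ⟨a, ha, fun x' => ?_⟩
    by_cases h' : f x' = ⊤
    · simp [h']
    obtain ⟨b, hb⟩ := hf.exists_coe_eq h'
    rw [hb, EReal.coe_le_coe_iff]
    -- compare with the points of the segment from `x` to `x'`, and let them tend to `x`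
    have key : ∀ t : ℝ, 0 < t → t ≤ 1 →
        0 ≤ b - a + inner ℝ v (x' - x) + c * (2 * inner ℝ (x - x₀) (x' - x))
          + t * (c * ‖x' - x‖ ^ 2) := by
      intro t ht0 ht1
      have h1 := (h (x + t • (x' - x))).trans
        (add_le_add_left (hf.le_segment ha.le hb.le ht0.le ht1) _)
      rw [proxObjective, ha, ← EReal.coe_add, ← EReal.coe_add, EReal.coe_le_coe_iff,
        norm_add_smul_sub_sq, inner_add_right, real_inner_smul_right] at h1
      refine nonneg_of_mul_nonneg_right (a := t) ?_ ht0
      linarith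
    have hlim : Tendsto (fun t : ℝ => b - a + inner ℝ v (x' - x)
        + c * (2 * inner ℝ (x - x₀) (x' - x)) + t * (c * ‖x' - x‖ ^ 2)) (𝓝[>] 0)
        (𝓝 (b - a + inner ℝ v (x' - x) + c * (2 * inner ℝ (x - x₀) (x' - x))
          + 0 * (c * ‖x' - x‖ ^ 2))) :=
      ((by fun_prop : Continuous fun t : ℝ => b - a + inner ℝ v (x' - x)
        + c * (2 * inner ℝ (x - x₀) (x' - x)) + t * (c * ‖x' - x‖ ^ 2)).tendsto 0).mono_left
        nhdsWithin_le_nhds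
    have h0 := ge_of_tendsto hlim (by
      filter_upwards [Ioc_mem_nhdsGT (zero_lt_one' ℝ)] with t ht using key t ht.1 ht.2)
    rw [inner_sub_left, inner_neg_left, real_inner_smul_left]
    linarith
  · rintro ⟨a, ha, h⟩ x'
    by_cases h' : f x' = ⊤
    · rw [proxObjective, proxObjective, h', EReal.top_add_coe]
      exact le_top
    obtain ⟨b, hb⟩ := hf.exists_coe_eq h'
    have h1 := h x'
    rw [hb, EReal.coe_le_coe_iff, inner_sub_left, inner_neg_left, real_inner_smul_left] at h1
    rw [proxObjective, proxObjective, ha, hb, ← EReal.coe_add, ← EReal.coe_add,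
      EReal.coe_le_coe_iff]
    have h2 := norm_add_smul_sub_sq x x₀ (x' - x) 1
    rw [one_smul, add_sub_cancel, one_pow, one_mul, one_mul] at h2
    have h3 : 0 ≤ c * ‖x' - x‖ ^ 2 := by positivity
    rw [h2]
    have h4 : inner ℝ v (x' - x) = inner ℝ v x' - inner ℝ v x := inner_sub_right ..
    linarith

/-- A proximal step has at most one result: the difference of two results would violate the
monotonicity of the subdifferential. -/
theorem HasSubgradientAt.prox_unique {f : E → EReal} {v x₀ x x' : E} {c : ℝ} (hc : 0 < c)
    (h : HasSubgradientAt f x (-v - c • (x - x₀)))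
    (h' : HasSubgradientAt f x' (-v - c • (x' - x₀))) : x = x' := by
  have := h.inner_sub_nonneg h'
  rw [show -v - c • (x - x₀) - (-v - c • (x' - x₀)) = -(c • (x - x')) by module,
    inner_neg_left, real_inner_smul_left, real_inner_self_eq_norm_sq] at this
  have h0 : ‖x - x'‖ ^ 2 = 0 := by
    have : 0 ≤ c * ‖x - x'‖ ^ 2 := by positivity
    have : c * ‖x - x'‖ ^ 2 = 0 := by linarith
    exact (mul_eq_zero.1 this).resolve_left hc.ne'
  exact sub_eq_zero.1 (norm_eq_zero.1 (pow_eq_zero_iff two_ne_zero |>.1 h0))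

/-- A closed proper convex function decreases at most linearly: compare it with its minimum over
the unit ball around a point of its domain, along rays issuing from that point. -/
theorem IsClosedProperConvex.exists_linear_lower_bound [FiniteDimensional ℝ E] {f : E → EReal}
    (hf : IsClosedProperConvex f) {x₁ : E} {a : ℝ} (ha : f x₁ = a) :
    ∃ D : ℝ, 0 ≤ D ∧ ∀ x, ((a - (‖x - x₁‖ + 1) * D : ℝ) : EReal) ≤ f x := by
  have : ProperSpace E := FiniteDimensional.proper ℝ E
  obtain ⟨z, -, hz⟩ := LowerSemicontinuousOn.exists_isMinOn
    (Metric.nonempty_closedBall.2 zero_le_one) (isCompact_closedBall x₁ 1)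
    (hf.lsc.lowerSemicontinuousOn _)
  have hmin : ∀ x, ‖x - x₁‖ ≤ 1 → f z ≤ f x := fun x hx =>
    hz (by rwa [Metric.mem_closedBall, dist_eq_norm])
  have hza : f z ≤ a := ha ▸ hmin x₁ (by simp)
  obtain ⟨m, hm⟩ := hf.exists_coe_eq (ne_top_of_le_ne_top (EReal.coe_ne_top _) hza)
  rw [hm, EReal.coe_le_coe_iff] at hza
  refine ⟨a - m, sub_nonneg.2 hza, fun x => ?_⟩
  by_cases hx : f x = ⊤
  · simp [hx]
  obtain ⟨b, hb⟩ := hf.exists_coe_eq hx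
  rw [hb, EReal.coe_le_coe_iff]
  have hD := mul_nonneg (norm_nonneg (x - x₁)) (sub_nonneg.2 hza)
  rcases le_total ‖x - x₁‖ 1 with h | h
  · have := hmin x h
    rw [hb, hm, EReal.coe_le_coe_iff] at this
    linarith
  · have hpos : 0 < ‖x - x₁‖ := by linarith
    have h1 := hmin (x₁ + ‖x - x₁‖⁻¹ • (x - x₁)) (by
      rw [add_sub_cancel_left, norm_smul, norm_inv, norm_norm, inv_mul_cancel₀ hpos.ne'])
    have h2 := h1.trans (hf.le_segment ha.le hb.le (inv_nonneg.2 hpos.le) (inv_le_one_of_one_le₀ h))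
    rw [hm, EReal.coe_le_coe_iff] at h2
    have h3 := mul_le_mul_of_nonneg_left h2 hpos.le
    rw [mul_add, mul_inv_cancel_left₀ hpos.ne'] at h3
    linarith

theorem IsClosedProperConvex.exists_isMin_proxObjective [FiniteDimensional ℝ E] {f : E → EReal}
    (hf : IsClosedProperConvex f) (v : E) {c : ℝ} (hc : 0 < c) (x₀ : E) :
    ∃ x, ∀ x', proxObjective f v c x₀ x ≤ proxObjective f v c x₀ x' := by
  have : ProperSpace E := FiniteDimensional.proper ℝ E
  obtain ⟨x₁, hx₁⟩ := hf.exists_ne_top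
  obtain ⟨a, ha⟩ := hf.exists_coe_eq hx₁
  obtain ⟨D, hD, hlow⟩ := hf.exists_linear_lower_bound ha
  have hlsc : LowerSemicontinuous (proxObjective f v c x₀) :=
    hf.lsc.add' (Continuous.lowerSemicontinuous
      (continuous_coe_real_ereal.comp (by fun_prop))) fun x =>
      EReal.continuousAt_add (.inr (EReal.coe_ne_bot _)) (.inr (EReal.coe_ne_top _))
  set K := ‖v + (2 * c) • (x₁ - x₀)‖ with hK
  have hK0 : 0 ≤ K := norm_nonneg _
  -- beyond this radius the quadratic term dominates the linear lower bound of `f`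
  set R := (2 * D + K) / c + 1 with hR
  have hR1 : 1 ≤ R := by
    have : 0 ≤ (2 * D + K) / c := by positivity
    linarith
  have hout : ∀ x, R ≤ ‖x - x₁‖ → proxObjective f v c x₀ x₁ ≤ proxObjective f v c x₀ x := by
    intro x hx
    refine le_trans ?_ (add_le_add_left (hlow x) _)
    rw [proxObjective, ha, ← EReal.coe_add, ← EReal.coe_add, EReal.coe_le_coe_iff]
    have h2 := norm_add_smul_sub_sq x₁ x₀ (x - x₁) 1
    rw [one_smul, add_sub_cancel, one_pow, one_mul, one_mul] at h2
    have h4 : inner ℝ v (x - x₁) = inner ℝ v x - inner ℝ v x₁ := inner_sub_right ..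
    have h5 : -(K * ‖x - x₁‖) ≤ inner ℝ (v + (2 * c) • (x₁ - x₀)) (x - x₁) :=
      (abs_le.1 (abs_real_inner_le_norm _ _)).1
    rw [inner_add_left, real_inner_smul_left] at h5
    have h6 : 2 * D + K ≤ c * ‖x - x₁‖ := by
      have : c * R = 2 * D + K + c := by rw [hR]; field_simp
      have := mul_le_mul_of_nonneg_left hx hc.le
      linarith
    have h7 := mul_le_mul_of_nonneg_right h6 (norm_nonneg (x - x₁))
    have h8 : D * 1 ≤ D * ‖x - x₁‖ := mul_le_mul_of_nonneg_left (hR1.trans hx) hD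
    rw [h2]
    linarith
  obtain ⟨z, -, hz⟩ := LowerSemicontinuousOn.exists_isMinOn
    (Metric.nonempty_closedBall.2 (zero_le_one.trans hR1)) (isCompact_closedBall x₁ R)
    (hlsc.lowerSemicontinuousOn _)
  refine ⟨z, fun x => ?_⟩
  rcases le_total ‖x - x₁‖ R with h | h
  · exact hz (by rwa [Metric.mem_closedBall, dist_eq_norm])
  · exact le_trans (hz (Metric.mem_closedBall_self (zero_le_one.trans hR1))) (hout x h)

end Subgradients

/-! ### Convergence for a monotone operator with a linear constraint -/

section MonotoneOperators

variable {H F : Type*} [NormedAddCommGroup H] [InnerProductSpace ℝ H]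
  [NormedAddCommGroup F] [InnerProductSpace ℝ F]

/-- Energy estimate between an iterate and a zero `(u*, y*)`: here `e = u⁺ - u*`, `d = u⁺ - u` and
`η = y - y*`, so that `B (e - d)` and `B e` are the old and new residuals. The hypothesis is
monotonicity at `u⁺` and `u*`. The term `lam² ‖B d‖² - ‖d‖²` may be positive, since `lam ‖B‖` may
exceed `1`. -/
theorem energy_le (B : H →L[ℝ] F) {γ lam : ℝ} (hγ : 0 < γ) (hlam : 0 < lam) (e d : H) (η : F)
    (h : 0 ≤ -inner ℝ (η + lam • B (e - d)) (B e) - (1 / lam) * inner ℝ d e) :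
    ‖e‖ ^ 2 + 1 / γ * ‖η + (γ * lam) • B e‖ ^ 2 - lam ^ 2 * ‖B e‖ ^ 2 ≤
      ‖e - d‖ ^ 2 + 1 / γ * ‖η‖ ^ 2 - lam ^ 2 * ‖B (e - d)‖ ^ 2 - ‖d‖ ^ 2 + lam ^ 2 * ‖B d‖ ^ 2
        - (2 - γ) * lam ^ 2 * ‖B e‖ ^ 2 := by
  have h1 : 0 ≤ 2 * lam * (-inner ℝ (η + lam • B (e - d)) (B e) - (1 / lam) * inner ℝ d e) := by
    positivity
  rw [← sub_nonneg]
  refine le_of_le_of_eq h1 ?_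
  simp only [← real_inner_self_eq_norm_sq, map_sub, inner_sub_left, inner_sub_right,
    inner_add_left, inner_add_right, real_inner_smul_left, real_inner_smul_right]
  rw [real_inner_comm e d, real_inner_comm (B e) (B d), real_inner_comm (B e) η]
  field_simp
  ring

/-- Decrease of the residual energy `γ lam² ‖B u‖² + ‖d‖² - (2 / s - 1) lam² ‖B d‖²`. Here `d` and
`d'` are successive increments and `r` is the residual between them; the hypothesis is monotonicity
at two consecutive iterates.

With `S = lam² B* B ≤ s`, the cross term is `2 ⟨d', (1 - S) d⟩`. For `N = 1 - (2 / s - 1) S` both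
`N + (1 - S)` and `N - (1 - S)` are nonnegative, so the cross term is at most
`⟨d', N d'⟩ + ⟨d, N d⟩`. This choice of `N` leads to the threshold `s < 4 / (2 + γ)`. -/
theorem residual_le (B : H →L[ℝ] F) {γ lam s : ℝ} (hlam : 0 < lam) (hs : 1 ≤ s)
    (hB : ∀ u, lam ^ 2 * ‖B u‖ ^ 2 ≤ s * ‖u‖ ^ 2) (d d' : H) (r : F)
    (h : 0 ≤ -inner ℝ ((γ * lam) • r + lam • B d) (B d') - (1 / lam) * inner ℝ (d' - d) d') :
    γ * lam ^ 2 * ‖r + B d'‖ ^ 2 + ‖d'‖ ^ 2 - (2 / s - 1) * lam ^ 2 * ‖B d'‖ ^ 2 ≤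
      γ * lam ^ 2 * ‖r‖ ^ 2 + ‖d‖ ^ 2 - (2 / s - 1) * lam ^ 2 * ‖B d‖ ^ 2
        - (4 / s - (2 + γ)) * lam ^ 2 * ‖B d'‖ ^ 2 := by
  have hs0 : 0 < s := by linarith
  have h1 : 0 ≤ 2 * lam *
      (-inner ℝ ((γ * lam) • r + lam • B d) (B d') - (1 / lam) * inner ℝ (d' - d) d') := by
    positivity
  -- `h2` and `h3` express `N + (1 - S) ≥ 0` at `d' - d` and `N - (1 - S) ≥ 0` at `d' + d`
  have h2 : 0 ≤ ‖d' - d‖ ^ 2 - 1 / s * (lam ^ 2 * ‖B (d' - d)‖ ^ 2) := by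
    have := mul_le_mul_of_nonneg_left (hB (d' - d)) (by positivity : 0 ≤ 1 / s)
    have e : 1 / s * (s * ‖d' - d‖ ^ 2) = ‖d' - d‖ ^ 2 := by field_simp
    linarith
  have h3 : 0 ≤ (1 - 1 / s) * (lam ^ 2 * ‖B (d' + d)‖ ^ 2) := by
    have : 0 ≤ 1 - 1 / s := by
      rw [sub_nonneg, div_le_one hs0]; exact hs
    positivity
  rw [← sub_nonneg]
  refine le_of_le_of_eq (add_nonneg (add_nonneg h1 h2) h3) ?_
  simp only [← real_inner_self_eq_norm_sq, map_sub, map_add, inner_sub_left, inner_sub_right,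
    inner_add_left, inner_add_right, real_inner_smul_left]
  rw [real_inner_comm d d', real_inner_comm (B d) (B d'), real_inner_comm r (B d')]
  field_simp
  ring

theorem inner_neg_adjoint_sub_smul [CompleteSpace H] [CompleteSpace F] (B : H →L[ℝ] F) (p : F)
    (c : ℝ) (d w : H) :
    inner ℝ (-(B.adjoint p) - c • d) w = -inner ℝ p (B w) - c * inner ℝ d w := by
  rw [inner_sub_left, inner_neg_left, ContinuousLinearMap.adjoint_inner_left, real_inner_smul_left]

/-- `(u k, y k)` is generated by the relaxed proximal multiplier iteration for the inclusion
`-B* y ∈ T u`, `B u = 0`: the primal step is `-B* p - (u⁺ - u) / lam ∈ T u⁺` with the predictor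
`p = y + lam B u`, and the dual step is relaxed by `γ`. The operator `T` is given by its graph. -/
structure IsProximalSequence [CompleteSpace H] [CompleteSpace F] (T : H → H → Prop)
    (B : H →L[ℝ] F) (γ lam : ℝ) (u : ℕ → H) (y : ℕ → F) : Prop where
  primal : ∀ k, T (u (k + 1))
    (-(B.adjoint (y k + lam • B (u k))) - (1 / lam) • (u (k + 1) - u k))
  dual : ∀ k, y (k + 1) = y k + (γ * lam) • B (u (k + 1))

/-- The Lyapunov function of the iteration for the reference pair `(us, ys)`: the energy of
`energy_le` plus `C` times the residual energy of `residual_le`. The index `k` refers to the iterate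
`k + 1` and its increment from the iterate `k`. -/
noncomputable def lyapunov (B : H →L[ℝ] F) (γ lam a C : ℝ) (us : H) (ys : F) (u : ℕ → H) (y : ℕ → F)
    (k : ℕ) : ℝ :=
  ‖u (k + 1) - us‖ ^ 2 + 1 / γ * ‖y (k + 1) - ys‖ ^ 2 - lam ^ 2 * ‖B (u (k + 1))‖ ^ 2
    + C * (γ * lam ^ 2 * ‖B (u (k + 1))‖ ^ 2 + ‖u (k + 1) - u k‖ ^ 2
      - a * lam ^ 2 * ‖B (u (k + 1) - u k)‖ ^ 2)

/-- The decrease of the residual energy, multiplied by `C`, absorbs the term `lam² ‖B d‖²` that the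
energy estimate leaves. -/
theorem IsProximalSequence.lyapunov_succ_le [CompleteSpace H] [CompleteSpace F]
    {T : H → H → Prop} {B : H →L[ℝ] F} {γ lam s C : ℝ} {u : ℕ → H} {y : ℕ → F}
    (hseq : IsProximalSequence T B γ lam u y)
    (hT : ∀ x ξ x' ξ', T x ξ → T x' ξ' → 0 ≤ inner ℝ (ξ - ξ') (x - x'))
    (hγ : 0 < γ) (hlam : 0 < lam) (hs : 1 ≤ s)
    (hB : ∀ u, lam ^ 2 * ‖B u‖ ^ 2 ≤ s * ‖u‖ ^ 2)
    (hC0 : 0 ≤ C) (hC : 1 ≤ C * (4 / s - (2 + γ)))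
    {us : H} {ys : F} (hus : B us = 0) (hTs : T us (-(B.adjoint ys))) (k : ℕ) :
    lyapunov B γ lam (2 / s - 1) C us ys u y (k + 1) + ‖u (k + 2) - u (k + 1)‖ ^ 2
        + (2 - γ) * lam ^ 2 * ‖B (u (k + 2))‖ ^ 2 ≤
      lyapunov B γ lam (2 / s - 1) C us ys u y k := by
  have hI := energy_le B hγ hlam (u (k + 2) - us) (u (k + 2) - u (k + 1)) (y (k + 1) - ys) (by
    have := hT _ _ _ _ (hseq.primal (k + 1)) hTs
    have e : -(B.adjoint (y (k + 1) + lam • B (u (k + 1)))) -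
        (1 / lam) • (u (k + 1 + 1) - u (k + 1)) - -(B.adjoint ys) =
        -(B.adjoint (y (k + 1) - ys + lam • B (u (k + 1)))) -
        (1 / lam) • (u (k + 1 + 1) - u (k + 1)) := by
      simp only [map_add, map_sub]; abel
    rw [e, inner_neg_adjoint_sub_smul] at this
    have e2 : B (u (k + 2) - us - (u (k + 2) - u (k + 1))) = B (u (k + 1)) := by
      simp only [map_sub, hus]; abel
    rw [e2]
    exact this)
  have hII := residual_le (γ := γ) B hlam hs hB (u (k + 1) - u k) (u (k + 2) - u (k + 1))
    (B (u (k + 1))) (by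
    have := hT _ _ _ _ (hseq.primal (k + 1)) (hseq.primal k)
    have e : -(B.adjoint (y (k + 1) + lam • B (u (k + 1)))) -
        (1 / lam) • (u (k + 1 + 1) - u (k + 1)) -
        (-(B.adjoint (y k + lam • B (u k))) - (1 / lam) • (u (k + 1) - u k)) =
        -(B.adjoint ((γ * lam) • B (u (k + 1)) + lam • B (u (k + 1) - u k))) -
        (1 / lam) • (u (k + 2) - u (k + 1) - (u (k + 1) - u k)) := by
      rw [hseq.dual k]
      simp only [map_add, map_sub, smul_sub]; abel
    rwa [e, inner_neg_adjoint_sub_smul] at this)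
  have e1 : u (k + 2) - us - (u (k + 2) - u (k + 1)) = u (k + 1) - us := by abel
  have e2 : y (k + 1) - ys + (γ * lam) • B (u (k + 2) - us) = y (k + 2) - ys := by
    rw [hseq.dual (k + 1), map_sub, hus, sub_zero]; abel
  have e3 : B (u (k + 1)) + B (u (k + 2) - u (k + 1)) = B (u (k + 2)) := by
    rw [map_sub]; abel
  have e4 : ∀ v, B (v - us) = B v := fun v => by rw [map_sub, hus, sub_zero]
  rw [e1, e2, e4, e4] at hI
  rw [e3] at hII
  have hCII := mul_le_mul_of_nonneg_left hII hC0
  have hd : lam ^ 2 * ‖B (u (k + 2) - u (k + 1))‖ ^ 2 ≤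
      C * (4 / s - (2 + γ)) * (lam ^ 2 * ‖B (u (k + 2) - u (k + 1))‖ ^ 2) :=
    le_mul_of_one_le_left (by positivity) hC
  simp only [lyapunov, add_assoc, one_add_one_eq_two] at *
  linarith

/-- The residual energy, multiplied by `C`, compensates the negative term of the Lyapunov function
and is otherwise nonnegative, because `(2 / s - 1) s = 2 - s ≤ 1`. -/
theorem le_lyapunov {B : H →L[ℝ] F} {γ lam s C : ℝ} (u : ℕ → H) (y : ℕ → F)
    (hs : 1 ≤ s) (hs2 : s ≤ 2)
    (hB : ∀ u, lam ^ 2 * ‖B u‖ ^ 2 ≤ s * ‖u‖ ^ 2)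
    (hC0 : 0 ≤ C) (hCγ : 1 ≤ C * γ) (us : H) (ys : F) (k : ℕ) :
    ‖u (k + 1) - us‖ ^ 2 + 1 / γ * ‖y (k + 1) - ys‖ ^ 2 ≤
      lyapunov B γ lam (2 / s - 1) C us ys u y k := by
  have hs0 : 0 < s := by linarith
  have h1 : (2 / s - 1) * (lam ^ 2 * ‖B (u (k + 1) - u k)‖ ^ 2) ≤ ‖u (k + 1) - u k‖ ^ 2 := by
    have ha : 0 ≤ 2 / s - 1 := by rw [sub_nonneg, le_div_iff₀ hs0]; linarith
    calc _ ≤ (2 / s - 1) * (s * ‖u (k + 1) - u k‖ ^ 2) :=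
          mul_le_mul_of_nonneg_left (hB _) ha
      _ = (2 - s) * ‖u (k + 1) - u k‖ ^ 2 := by field_simp
      _ ≤ 1 * ‖u (k + 1) - u k‖ ^ 2 := by gcongr; linarith
      _ = _ := one_mul _
  have h2 := mul_nonneg hC0 (sub_nonneg.2 h1)
  have h3 : lam ^ 2 * ‖B (u (k + 1))‖ ^ 2 ≤ C * γ * (lam ^ 2 * ‖B (u (k + 1))‖ ^ 2) :=
    le_mul_of_one_le_left (by positivity) hCγ
  unfold lyapunov
  linarith

/-- Convergence to a zero for a monotone operator with closed graph. The Lyapunov function of a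
given zero shows that the iterates are bounded and that increments and residuals vanish, so that every
cluster point is a zero. The Lyapunov function of a cluster point is antitone and tends to zero
along a subsequence, hence tends to zero. -/
theorem IsProximalSequence.tendsto [FiniteDimensional ℝ H] [FiniteDimensional ℝ F]
    [CompleteSpace H] [CompleteSpace F]
    {T : H → H → Prop} {B : H →L[ℝ] F} {γ lam s : ℝ} {u : ℕ → H} {y : ℕ → F}
    (hseq : IsProximalSequence T B γ lam u y)
    (hT : ∀ x ξ x' ξ', T x ξ → T x' ξ' → 0 ≤ inner ℝ (ξ - ξ') (x - x'))
    (hTc : ∀ (x ξ : ℕ → H) (x₀ ξ₀ : H), (∀ k, T (x k) (ξ k)) → Tendsto x atTop (𝓝 x₀) →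
      Tendsto ξ atTop (𝓝 ξ₀) → T x₀ ξ₀)
    (hγ : 0 < γ) (hγ2 : γ < 2) (hlam : 0 < lam) (hs : 1 ≤ s) (hsγ : s < 4 / (2 + γ))
    (hB : ∀ u, lam ^ 2 * ‖B u‖ ^ 2 ≤ s * ‖u‖ ^ 2)
    (hzero : ∃ us ys, B us = 0 ∧ T us (-(B.adjoint ys))) :
    ∃ us ys, B us = 0 ∧ T us (-(B.adjoint ys)) ∧ Tendsto u atTop (𝓝 us) ∧
      Tendsto y atTop (𝓝 ys) := by
  have hs0 : 0 < s := by linarith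
  have hs2 : s ≤ 2 := hsγ.le.trans (by rw [div_le_iff₀ (by linarith)]; linarith)
  have hc : 0 < 4 / s - (2 + γ) := by
    rw [sub_pos, lt_div_iff₀ hs0]
    rw [lt_div_iff₀ (by linarith)] at hsγ
    linarith
  obtain ⟨C, hC0, hC, hCγ⟩ : ∃ C : ℝ, 0 ≤ C ∧ 1 ≤ C * (4 / s - (2 + γ)) ∧ 1 ≤ C * γ := by
    refine ⟨1 / (4 / s - (2 + γ)) + 1 / γ, by positivity, ?_, ?_⟩
    · rw [add_mul, one_div_mul_cancel hc.ne']
      have : 0 ≤ 1 / γ * (4 / s - (2 + γ)) := by positivity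
      linarith
    · rw [add_mul, one_div_mul_cancel hγ.ne']
      have : 0 ≤ 1 / (4 / s - (2 + γ)) * γ := by positivity
      linarith
  have hdec : ∀ us ys, B us = 0 → T us (-(B.adjoint ys)) → ∀ k,
      lyapunov B γ lam (2 / s - 1) C us ys u y (k + 1) + ‖u (k + 2) - u (k + 1)‖ ^ 2
        + (2 - γ) * lam ^ 2 * ‖B (u (k + 2))‖ ^ 2 ≤
      lyapunov B γ lam (2 / s - 1) C us ys u y k := fun us ys h1 h2 k =>
    hseq.lyapunov_succ_le hT hγ hlam hs hB hC0 hC h1 h2 k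
  have hge := fun us ys k => le_lyapunov (γ := γ) u y hs hs2 hB hC0 hCγ us ys k
  have hnn : ∀ us ys k, 0 ≤ lyapunov B γ lam (2 / s - 1) C us ys u y k := fun us ys k =>
    le_trans (by positivity) (hge us ys k)
  have hγ2' : 0 < (2 - γ) * lam ^ 2 := mul_pos (by linarith) (by positivity)
  have hanti : ∀ us ys, B us = 0 → T us (-(B.adjoint ys)) →
      Antitone (lyapunov B γ lam (2 / s - 1) C us ys u y) := fun us ys h1 h2 =>
    antitone_nat_of_succ_le fun k => by
      have := hdec us ys h1 h2 k
      have := mul_nonneg hγ2'.le (sq_nonneg ‖B (u (k + 2))‖)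
      have := sq_nonneg ‖u (k + 2) - u (k + 1)‖
      linarith
  have hlim : ∀ us ys, B us = 0 → T us (-(B.adjoint ys)) →
      ∃ l, Tendsto (lyapunov B γ lam (2 / s - 1) C us ys u y) atTop (𝓝 l) := fun us ys h1 h2 =>
    ⟨_, tendsto_atTop_ciInf (hanti us ys h1 h2) ⟨0, by rintro _ ⟨k, rfl⟩; exact hnn us ys k⟩⟩
  obtain ⟨u₀, y₀, hu₀, hy₀⟩ := hzero
  obtain ⟨l, hl⟩ := hlim u₀ y₀ hu₀ hy₀
  -- the Lyapunov function converges, so its decrements tend to zero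
  have hdiff := hl.sub (hl.comp (tendsto_add_atTop_nat 1))
  rw [sub_self] at hdiff
  have hd : Tendsto (fun k => u (k + 1) - u k) atTop (𝓝 0) := by
    rw [← tendsto_add_atTop_iff_nat 1, tendsto_zero_iff_norm_tendsto_zero]
    have : Tendsto (fun k => ‖u (k + 1 + 1) - u (k + 1)‖ ^ 2) atTop (𝓝 0) :=
      squeeze_zero (fun k => by positivity) (fun k => by
        have := hdec u₀ y₀ hu₀ hy₀ k
        have := mul_nonneg hγ2'.le (sq_nonneg ‖B (u (k + 2))‖)
        simp only [Function.comp]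
        linarith) hdiff
    simpa using this.sqrt
  have hr : Tendsto (fun k => B (u k)) atTop (𝓝 0) := by
    rw [← tendsto_add_atTop_iff_nat 2, tendsto_zero_iff_norm_tendsto_zero]
    have : Tendsto (fun k => (2 - γ) * lam ^ 2 * ‖B (u (k + 2))‖ ^ 2) atTop (𝓝 0) :=
      squeeze_zero (fun k => by positivity) (fun k => by
        have := hdec u₀ y₀ hu₀ hy₀ k
        have := sq_nonneg ‖u (k + 2) - u (k + 1)‖
        simp only [Function.comp]
        linarith) hdiff
    have h2 := (this.const_mul ((2 - γ) * lam ^ 2)⁻¹).sqrt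
    simpa only [inv_mul_cancel_left₀ hγ2'.ne', Real.sqrt_sq (norm_nonneg _), mul_zero,
      Real.sqrt_zero] using h2
  have hBd : Tendsto (fun k => B (u (k + 1) - u k)) atTop (𝓝 0) := by
    simpa only [map_zero, Function.comp_def] using (B.continuous.tendsto 0).comp hd
  -- boundedness and a cluster point
  have hbdd : ∃ R, ∀ k, (u (k + 1), y (k + 1)) ∈ Metric.closedBall (u₀, y₀) R := by
    set M := lyapunov B γ lam (2 / s - 1) C u₀ y₀ u y 0
    refine ⟨max (√M) (√(γ * M)), fun k => ?_⟩
    have h1 := (hge u₀ y₀ k).trans (hanti u₀ y₀ hu₀ hy₀ (Nat.zero_le k))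
    rw [Metric.mem_closedBall, Prod.dist_eq, dist_eq_norm, dist_eq_norm]
    refine max_le_max (Real.le_sqrt_of_sq_le ?_) (Real.le_sqrt_of_sq_le ?_)
    · have : 0 ≤ 1 / γ * ‖y (k + 1) - y₀‖ ^ 2 := by positivity
      exact le_trans (by linarith) h1
    · have h2 : 1 / γ * ‖y (k + 1) - y₀‖ ^ 2 ≤ M :=
        le_trans (le_add_of_nonneg_left (by positivity)) h1
      rwa [one_div, inv_mul_le_iff₀ hγ] at h2
  obtain ⟨R, hR⟩ := hbdd
  have : ProperSpace H := FiniteDimensional.proper ℝ H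
  have : ProperSpace F := FiniteDimensional.proper ℝ F
  obtain ⟨⟨us, ys⟩, -, φ, hφ, hlimφ⟩ := tendsto_subseq_of_bounded Metric.isBounded_closedBall hR
  have hus : Tendsto (fun k => u (φ k + 1)) atTop (𝓝 us) := (continuous_fst.tendsto _).comp hlimφ
  have hys : Tendsto (fun k => y (φ k + 1)) atTop (𝓝 ys) := (continuous_snd.tendsto _).comp hlimφ
  have hφt := hφ.tendsto_atTop
  have hφ1 : Tendsto (fun k => φ k + 1) atTop atTop := (tendsto_add_atTop_nat 1).comp hφt
  have hBus : B us = 0 :=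
    tendsto_nhds_unique ((B.continuous.tendsto us).comp hus) (hr.comp hφ1)
  have hTus : T us (-(B.adjoint ys)) := by
    refine hTc (fun k => u (φ k + 1 + 1)) _ _ _ (fun k => hseq.primal (φ k + 1)) ?_ ?_
    · simpa using (hd.comp hφ1).add hus
    · have h1 : Tendsto (fun k => y (φ k + 1) + lam • B (u (φ k + 1))) atTop (𝓝 ys) := by
        simpa using hys.add ((hr.comp hφ1).const_smul lam)
      have h2 := ((B.adjoint.continuous.tendsto ys).comp h1).neg.sub
        ((hd.comp hφ1).const_smul (1 / lam))
      simpa using h2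
  -- the Lyapunov function of the cluster point tends to zero along a subsequence, hence overall
  obtain ⟨l', hl'⟩ := hlim us ys hBus hTus
  have hsub : Tendsto (fun k => lyapunov B γ lam (2 / s - 1) C us ys u y (φ k)) atTop (𝓝 0) := by
    have h1 := (hus.sub_const us).norm.pow 2
    have h2 := ((hys.sub_const ys).norm.pow 2).const_mul (1 / γ)
    have h3 := ((hr.comp hφ1).norm.pow 2).const_mul (lam ^ 2)
    have h4 := ((hr.comp hφ1).norm.pow 2).const_mul (γ * lam ^ 2)
    have h5 := (hd.comp hφt).norm.pow 2
    have h6 := ((hBd.comp hφt).norm.pow 2).const_mul ((2 / s - 1) * lam ^ 2)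
    have := ((h1.add h2).sub h3).add (((h4.add h5).sub h6).const_mul C)
    simpa [lyapunov, Function.comp_def] using this
  have hl0 : l' = 0 := tendsto_nhds_unique (hl'.comp hφt) hsub
  rw [hl0] at hl'
  refine ⟨us, ys, hBus, hTus, ?_, ?_⟩
  · rw [← tendsto_add_atTop_iff_nat 1, tendsto_iff_norm_sub_tendsto_zero]
    have : Tendsto (fun k => ‖u (k + 1) - us‖ ^ 2) atTop (𝓝 0) :=
      squeeze_zero (fun k => by positivity) (fun k =>
        (le_add_of_nonneg_right (by positivity)).trans (hge us ys k)) hl'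
    simpa using this.sqrt
  · rw [← tendsto_add_atTop_iff_nat 1, tendsto_iff_norm_sub_tendsto_zero]
    have : Tendsto (fun k => 1 / γ * ‖y (k + 1) - ys‖ ^ 2) atTop (𝓝 0) :=
      squeeze_zero (fun k => by positivity) (fun k =>
        (le_add_of_nonneg_left (by positivity)).trans (hge us ys k)) hl'
    have h2 := (this.const_mul γ).sqrt
    have e : ∀ x : ℝ, γ * (1 / γ * x) = x := fun x => by field_simp
    simpa only [e, Real.sqrt_sq (norm_nonneg _), mul_zero, Real.sqrt_zero] using h2

end MonotoneOperators

/-! ### Saddle points and multipliers -/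

section SaddlePoints

variable {E F : Type*} [NormedAddCommGroup E] [InnerProductSpace ℝ E]
  [NormedAddCommGroup F] [InnerProductSpace ℝ F]

theorem lagrangian_coe {A : E →L[ℝ] F} {f : E → EReal} {g : F → EReal} {x : E} {z : F} {a b : ℝ}
    (ha : f x = a) (hb : g z = b) (y : F) :
    lagrangian A f g x z y = ((a + b + inner ℝ y (A x - z) : ℝ) : EReal) := by
  rw [lagrangian, ha, hb, ← EReal.coe_add, ← EReal.coe_add]

theorem lagrangian_eq_top {A : E →L[ℝ] F} {f : E → EReal} {g : F → EReal} {x : E} {z : F}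
    (hf : IsClosedProperConvex f) (hg : IsClosedProperConvex g) (h : f x = ⊤ ∨ g z = ⊤) (y : F) :
    lagrangian A f g x z y = ⊤ := by
  rcases h with h | h
  · rw [lagrangian, h, EReal.top_add_of_ne_bot (hg.ne_bot z), EReal.top_add_coe]
  · rw [lagrangian, h, EReal.add_top_of_ne_bot (hf.ne_bot x), EReal.top_add_coe]

/-- Saddle points are the solutions of the optimality system `A x = z`, `-A* y ∈ ∂f(x)`,
`y ∈ ∂g(z)`. -/
theorem isSaddlePoint_iff [CompleteSpace E] [CompleteSpace F] {A : E →L[ℝ] F} {f : E → EReal}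
    {g : F → EReal} (hf : IsClosedProperConvex f) (hg : IsClosedProperConvex g) {x : E} {z y : F} :
    IsSaddlePoint A f g x z y ↔
      A x = z ∧ HasSubgradientAt f x (-(A.adjoint y)) ∧ HasSubgradientAt g z y := by
  constructor
  · rintro ⟨hmax, hmin⟩
    obtain ⟨x₁, hx₁⟩ := hf.exists_ne_top
    obtain ⟨a₁, ha₁⟩ := hf.exists_coe_eq hx₁
    obtain ⟨z₁, hz₁⟩ := hg.exists_ne_top
    obtain ⟨b₁, hb₁⟩ := hg.exists_coe_eq hz₁
    have hfin : ¬ (f x = ⊤ ∨ g z = ⊤) := fun h => by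
      have := hmin x₁ z₁
      rw [lagrangian_eq_top hf hg h, lagrangian_coe ha₁ hb₁, top_le_iff] at this
      exact EReal.coe_ne_top _ this
    obtain ⟨a, ha⟩ := hf.exists_coe_eq fun h => hfin (.inl h)
    obtain ⟨b, hb⟩ := hg.exists_coe_eq fun h => hfin (.inr h)
    refine ⟨?_, ⟨a, ha, fun x' => ?_⟩, ⟨b, hb, fun z' => ?_⟩⟩
    -- an infeasible point would allow an increase in the direction `A x - z`
    · have := hmax (y + (A x - z))
      rw [lagrangian_coe ha hb, lagrangian_coe ha hb, EReal.coe_le_coe_iff, inner_add_left,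
        real_inner_self_eq_norm_sq] at this
      have h0 : ‖A x - z‖ ^ 2 = 0 := le_antisymm (by linarith) (by positivity)
      exact sub_eq_zero.1 (norm_eq_zero.1 (pow_eq_zero_iff two_ne_zero |>.1 h0))
    · by_cases h' : f x' = ⊤
      · simp [h']
      obtain ⟨a', ha'⟩ := hf.exists_coe_eq h'
      have := hmin x' z
      rw [lagrangian_coe ha hb, lagrangian_coe ha' hb, EReal.coe_le_coe_iff] at this
      rw [ha', EReal.coe_le_coe_iff, inner_neg_left, ContinuousLinearMap.adjoint_inner_left]
      simp only [map_sub, inner_sub_right] at this ⊢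
      linarith
    · by_cases h' : g z' = ⊤
      · simp [h']
      obtain ⟨b', hb'⟩ := hg.exists_coe_eq h'
      have := hmin x z'
      rw [lagrangian_coe ha hb, lagrangian_coe ha hb', EReal.coe_le_coe_iff] at this
      rw [hb', EReal.coe_le_coe_iff]
      simp only [inner_sub_right] at this ⊢
      linarith
  · rintro ⟨hA, ⟨a, ha, hf'⟩, ⟨b, hb, hg'⟩⟩
    refine ⟨fun y' => ?_, fun x' z' => ?_⟩
    · rw [lagrangian_coe ha hb, lagrangian_coe ha hb, hA]
      simp
    · by_cases h : f x' = ⊤ ∨ g z' = ⊤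
      · rw [lagrangian_eq_top hf hg h]
        exact le_top
      rw [not_or] at h
      obtain ⟨a', ha'⟩ := hf.exists_coe_eq h.1
      obtain ⟨b', hb'⟩ := hg.exists_coe_eq h.2
      have h1 := hf' x'
      have h2 := hg' z'
      rw [ha', EReal.coe_le_coe_iff, inner_neg_left, ContinuousLinearMap.adjoint_inner_left] at h1
      rw [hb', EReal.coe_le_coe_iff] at h2
      rw [lagrangian_coe ha hb, lagrangian_coe ha' hb', EReal.coe_le_coe_iff]
      simp only [map_sub, inner_sub_right] at h1 h2 ⊢
      linarith

theorem IsSaddlePoint.isSolution [CompleteSpace E] [CompleteSpace F] {A : E →L[ℝ] F}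
    {f : E → EReal} {g : F → EReal} (hf : IsClosedProperConvex f) (hg : IsClosedProperConvex g)
    {x : E} {z y : F} (h : IsSaddlePoint A f g x z y) : IsSolution A f g x z := by
  obtain ⟨hA, ⟨a, ha, -⟩, ⟨b, hb, -⟩⟩ := (isSaddlePoint_iff hf hg).1 h
  refine ⟨hA, ?_, fun x' z' h' => ?_⟩
  · rw [ha, hb, ← EReal.coe_add]
    exact EReal.coe_ne_top _
  · simpa [lagrangian, hA, h'] using h.2 x' z'

theorem IsClosedProperConvex.convexOn_toReal {f : E → EReal} (hf : IsClosedProperConvex f)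
    (hfin : ∀ x, f x ≠ ⊤) : ConvexOn ℝ Set.univ fun x => (f x).toReal := by
  refine ⟨convex_univ, fun x _ x' _ s t hs ht hst => ?_⟩
  have h := hf.convex_epigraph (x := (x, (f x).toReal)) (EReal.le_coe_toReal (hfin x))
    (y := (x', (f x').toReal)) (EReal.le_coe_toReal (hfin x')) hs ht hst
  rw [← EReal.coe_le_coe_iff, EReal.coe_toReal (hfin _) (hf.ne_bot _)]
  exact h

/-- For real-valued convex functions every solution has a multiplier. The strict epigraph of
`(x, w) ↦ f x + g (A x + w)`, projected to the perturbations `w`, is open and convex and misses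
the point of optimal value over `w = 0`; a separating hyperplane is the graph of the multiplier. -/
theorem IsSolution.exists_isSaddlePoint [FiniteDimensional ℝ F]
    {A : E →L[ℝ] F} {f : E → EReal} {g : F → EReal} (hf : IsClosedProperConvex f)
    (hg : IsClosedProperConvex g) (hf' : ∀ x, f x ≠ ⊤) (hg' : ∀ z, g z ≠ ⊤) {x : E} {z : F}
    (h : IsSolution A f g x z) : ∃ y, IsSaddlePoint A f g x z y := by
  have : CompleteSpace F := FiniteDimensional.complete ℝ F
  set φ : E → ℝ := fun x => (f x).toReal with hφ
  set ψ : F → ℝ := fun z => (g z).toReal with hψ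
  have hfφ : ∀ x, f x = φ x := fun x => (EReal.coe_toReal (hf' x) (hf.ne_bot x)).symm
  have hgψ : ∀ z, g z = ψ z := fun z => (EReal.coe_toReal (hg' z) (hg.ne_bot z)).symm
  have hφc : ConvexOn ℝ Set.univ φ := hf.convexOn_toReal hf'
  have hψc : ConvexOn ℝ Set.univ ψ := hg.convexOn_toReal hg'
  have hψcont : Continuous ψ := hψc.locallyLipschitz.continuous
  have hmin : ∀ x', φ x + ψ z ≤ φ x' + ψ (A x') := fun x' => by
    have := h.minimal x' _ rfl
    rwa [hfφ, hgψ, hfφ, hgψ, ← EReal.coe_add, ← EReal.coe_add, EReal.coe_le_coe_iff] at this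
  let S : Set (F × ℝ) := {q | ∃ x', φ x' + ψ (A x' + q.1) < q.2}
  have hSo : IsOpen S := by
    have : S = ⋃ x', {q : F × ℝ | φ x' + ψ (A x' + q.1) < q.2} := by
      ext q; simp [S]
    rw [this]
    exact isOpen_iUnion fun x' => isOpen_lt (by fun_prop) (by fun_prop)
  have hSc : Convex ℝ S := by
    rintro ⟨w₁, r₁⟩ ⟨x₁, h₁⟩ ⟨w₂, r₂⟩ ⟨x₂, h₂⟩ s t hs ht hst
    refine ⟨s • x₁ + t • x₂, ?_⟩
    have e : A (s • x₁ + t • x₂) + (s • w₁ + t • w₂) = s • (A x₁ + w₁) + t • (A x₂ + w₂) := by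
      rw [map_add, map_smul, map_smul]; module
    have h3 := hφc.2 (Set.mem_univ x₁) (Set.mem_univ x₂) hs ht hst
    have h4 := hψc.2 (Set.mem_univ (A x₁ + w₁)) (Set.mem_univ (A x₂ + w₂)) hs ht hst
    simp only [smul_eq_mul] at h3 h4
    show φ (s • x₁ + t • x₂) + ψ (A (s • x₁ + t • x₂) + (s • w₁ + t • w₂)) < s * r₁ + t * r₂
    rw [e]
    simp only at h₁ h₂
    have h5 : s * (φ x₁ + ψ (A x₁ + w₁)) + t * (φ x₂ + ψ (A x₂ + w₂)) < s * r₁ + t * r₂ := by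
      rcases hs.eq_or_lt with rfl | hs
      · have : t = 1 := by linarith
        subst this; linarith
      · exact add_lt_add_of_lt_of_le (mul_lt_mul_of_pos_left h₁ hs)
          (mul_le_mul_of_nonneg_left h₂.le ht)
    linarith
  have hS0 : ((0 : F), φ x + ψ z) ∉ S := by
    rintro ⟨x', hx'⟩
    rw [add_zero] at hx'
    exact (hmin x').not_gt hx'
  obtain ⟨ℓ, hℓ⟩ := geometric_hahn_banach_open_point hSc hSo hS0
  set μ := ℓ (0, 1) with hμ
  have hdecomp : ∀ w r, ℓ (w, r) = ℓ (w, 0) + r * μ := fun w r => by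
    rw [hμ, ← smul_eq_mul, ← map_smul, ← map_add]
    simp
  -- the hyperplane is not vertical, because `S` contains a half-line over `w = 0`
  have hμ0 : μ < 0 := by
    have := hℓ (0, φ x + ψ z + 1) ⟨x, by simp [h.feasible]⟩
    rw [hdecomp 0 (φ x + ψ z + 1), hdecomp 0 (φ x + ψ z)] at this
    linarith
  have hsupp : ∀ x' w, μ * (φ x' + ψ (A x' + w)) + ℓ (w, 0) ≤ μ * (φ x + ψ z) := fun x' w => by
    have hlim : Tendsto (fun r : ℝ => ℓ (w, 0) + r * μ) (𝓝[>] (φ x' + ψ (A x' + w)))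
        (𝓝 (ℓ (w, 0) + (φ x' + ψ (A x' + w)) * μ)) :=
      ((by fun_prop : Continuous fun r : ℝ => ℓ (w, 0) + r * μ).tendsto _).mono_left
        nhdsWithin_le_nhds
    have := le_of_tendsto hlim (b := ℓ (0, φ x + ψ z)) (by
      filter_upwards [self_mem_nhdsWithin] with r hr
      rw [← hdecomp]
      exact (hℓ (w, r) ⟨x', hr⟩).le)
    rw [hdecomp 0, show ((0 : F), (0 : ℝ)) = 0 from rfl, map_zero] at this
    linarith
  set q := (InnerProductSpace.toDual ℝ F).symm (ℓ.comp (ContinuousLinearMap.inl ℝ F ℝ)) with hq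
  have hqℓ : ∀ w, inner ℝ q w = ℓ (w, 0) := fun w => by
    rw [hq, InnerProductSpace.toDual_symm_apply]; simp
  refine ⟨(-μ)⁻¹ • q, fun y' => ?_, fun x' z' => ?_⟩
  · rw [lagrangian_coe (hfφ x) (hgψ z), lagrangian_coe (hfφ x) (hgψ z), h.feasible]
    simp
  · rw [lagrangian_coe (hfφ x) (hgψ z), lagrangian_coe (hfφ x') (hgψ z'), EReal.coe_le_coe_iff,
      h.feasible, sub_self, inner_zero_right, add_zero, real_inner_smul_left]
    have := hsupp x' (z' - A x')
    rw [add_sub_cancel, ← hqℓ, ← neg_sub (A x'), inner_neg_right] at this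
    refine le_of_mul_le_mul_left ?_ (neg_pos.2 hμ0)
    rw [mul_add _ (_ + _) (_ * _), mul_inv_cancel_left₀ (neg_pos.2 hμ0).ne']
    linarith

end SaddlePoints

/-! ### The method as a proximal iteration for the constraint map -/

section Iteration

variable {E F : Type*} [NormedAddCommGroup E] [InnerProductSpace ℝ E]
  [NormedAddCommGroup F] [InnerProductSpace ℝ F]

/-- Fermat's rule turns a step of the method into an inclusion for the two subdifferentials, which
determines the new iterate. -/
theorem gpcpmStep_iff [CompleteSpace E] [CompleteSpace F] {A : E →L[ℝ] F} {f : E → EReal}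
    {g : F → EReal} (hf : IsClosedProperConvex f) (hg : IsClosedProperConvex g) {γ lam : ℝ}
    (hlam : 0 < lam) (w w' : E × F × F) :
    GPCPMStep A f g γ lam w w' ↔
      HasSubgradientAt f w'.1
        (-(A.adjoint (predictor A lam w)) - (1 / lam) • (w'.1 - w.1)) ∧
      HasSubgradientAt g w'.2.1 (-(-predictor A lam w) - (1 / lam) • (w'.2.1 - w.2.1)) ∧
      w'.2.2 = w.2.2 + (γ * lam) • (A w'.1 - w'.2.1) := by
  have hc : 0 ≤ 1 / (2 * lam) := by positivity
  have e : 1 / lam = 2 * (1 / (2 * lam)) := by field_simp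
  rw [e, ← hf.isMin_proxObjective_iff _ hc, ← hg.isMin_proxObjective_iff _ hc]
  simp only [proxObjective, ContinuousLinearMap.adjoint_inner_left, inner_neg_left]
  exact ⟨fun h => ⟨h.x_step, h.z_step, h.y_step⟩, fun h => ⟨h.1, h.2.1, h.2.2⟩⟩

theorem existsUnique_gpcpmStep [FiniteDimensional ℝ E] [FiniteDimensional ℝ F] {A : E →L[ℝ] F}
    {f : E → EReal} {g : F → EReal} (hf : IsClosedProperConvex f) (hg : IsClosedProperConvex g)
    (γ : ℝ) {lam : ℝ} (hlam : 0 < lam) (w : E × F × F) : ∃! w', GPCPMStep A f g γ lam w w' := by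
  have : CompleteSpace E := FiniteDimensional.complete ℝ E
  have : CompleteSpace F := FiniteDimensional.complete ℝ F
  have hc : 0 < 1 / (2 * lam) := by positivity
  have e : 2 * (1 / (2 * lam)) = 1 / lam := by field_simp
  obtain ⟨x, hx⟩ := hf.exists_isMin_proxObjective (A.adjoint (predictor A lam w)) hc w.1
  obtain ⟨z, hz⟩ := hg.exists_isMin_proxObjective (-predictor A lam w) hc w.2.1
  rw [hf.isMin_proxObjective_iff _ hc.le, e] at hx
  rw [hg.isMin_proxObjective_iff _ hc.le, e] at hz
  refine ⟨(x, z, w.2.2 + (γ * lam) • (A x - z)), (gpcpmStep_iff hf hg hlam _ _).2 ⟨hx, hz, rfl⟩, ?_⟩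
  rintro ⟨x', z', y'⟩ h
  obtain ⟨hx', hz', hy'⟩ := (gpcpmStep_iff hf hg hlam _ _).1 h
  obtain rfl : x' = x := hx'.prox_unique (by positivity) hx
  obtain rfl : z' = z := hz'.prox_unique (by positivity) hz
  rw [← hy']

theorem existsUnique_seq_of_existsUnique_step {α : Type*} {step : α → α → Prop}
    (h : ∀ a, ∃! b, step a b) (a : α) : ∃! w : ℕ → α, w 0 = a ∧ ∀ k, step (w k) (w (k + 1)) := by
  choose next hnext huniq using h
  refine ⟨fun k => next^[k] a, ⟨rfl, fun k => ?_⟩, fun w hw => funext fun k => ?_⟩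
  · simp only [Function.iterate_succ_apply']
    exact hnext _
  · induction k with
    | zero => exact hw.1
    | succ k ih =>
      simp only [Function.iterate_succ_apply'] at ih ⊢
      rw [← ih]
      exact huniq _ _ (hw.2 k)

/-- The constraint map `(x, z) ↦ A x - z` on the Hilbert space product of `E` and `F`, whose `L²`
norm makes `‖(x, z)‖² = ‖x‖² + ‖z‖²`. -/
noncomputable def constraintMap (A : E →L[ℝ] F) : WithLp 2 (E × F) →L[ℝ] F :=
  A ∘L WithLp.fstL 2 ℝ E F - WithLp.sndL 2 ℝ E F

theorem constraintMap_apply (A : E →L[ℝ] F) (u : WithLp 2 (E × F)) :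
    constraintMap A u = A u.fst - u.snd := rfl

theorem adjoint_constraintMap [CompleteSpace E] [CompleteSpace F] (A : E →L[ℝ] F) (y : F) :
    (constraintMap A).adjoint y = WithLp.toLp 2 (A.adjoint y, -y) := by
  refine ext_inner_right ℝ fun u => ?_
  rw [ContinuousLinearMap.adjoint_inner_left, WithLp.prod_inner_apply, constraintMap_apply]
  rw [inner_sub_right, sub_eq_add_neg, ← ContinuousLinearMap.adjoint_inner_left, ← inner_neg_left]
  rfl

theorem norm_constraintMap_sq_le (A : E →L[ℝ] F) (u : WithLp 2 (E × F)) :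
    ‖constraintMap A u‖ ^ 2 ≤ (‖A‖ ^ 2 + 1) * ‖u‖ ^ 2 := by
  rw [constraintMap_apply, WithLp.prod_norm_sq_eq_of_L2]
  have h : ‖A u.fst - u.snd‖ ≤ ‖A‖ * ‖u.fst‖ + ‖u.snd‖ :=
    (norm_sub_le _ _).trans (add_le_add_left (A.le_opNorm _) _)
  have h2 := pow_le_pow_left₀ (norm_nonneg _) h 2
  have h3 := sq_nonneg (‖A‖ * ‖u.snd‖ - ‖u.fst‖)
  linarith

/-- The graph of the product operator `∂f × ∂g`, the subdifferential of `(x, z) ↦ f x + g z`. -/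
def prodSubdifferential (f : E → EReal) (g : F → EReal) (u ξ : WithLp 2 (E × F)) : Prop :=
  HasSubgradientAt f u.fst ξ.fst ∧ HasSubgradientAt g u.snd ξ.snd

theorem isSaddlePoint_iff_prodSubdifferential [CompleteSpace E] [CompleteSpace F] {A : E →L[ℝ] F}
    {f : E → EReal} {g : F → EReal} (hf : IsClosedProperConvex f) (hg : IsClosedProperConvex g)
    (u : WithLp 2 (E × F)) (y : F) :
    IsSaddlePoint A f g u.fst u.snd y ↔
      constraintMap A u = 0 ∧ prodSubdifferential f g u (-((constraintMap A).adjoint y)) := by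
  rw [isSaddlePoint_iff hf hg, constraintMap_apply, sub_eq_zero, adjoint_constraintMap,
    prodSubdifferential]
  simp

theorem isProximalSequence_of_gpcpmStep [CompleteSpace E] [CompleteSpace F] {A : E →L[ℝ] F}
    {f : E → EReal} {g : F → EReal} (hf : IsClosedProperConvex f) (hg : IsClosedProperConvex g)
    {γ lam : ℝ} (hlam : 0 < lam) {w : ℕ → E × F × F}
    (hw : ∀ k, GPCPMStep A f g γ lam (w k) (w (k + 1))) :
    IsProximalSequence (prodSubdifferential f g) (constraintMap A) γ lam
      (fun k => WithLp.toLp 2 ((w k).1, (w k).2.1)) fun k => (w k).2.2 := by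
  refine ⟨fun k => ?_, fun k => ((gpcpmStep_iff hf hg hlam _ _).1 (hw k)).2.2⟩
  obtain ⟨h1, h2, -⟩ := (gpcpmStep_iff hf hg hlam _ _).1 (hw k)
  rw [adjoint_constraintMap]
  exact ⟨h1, h2⟩

/-- The bound on the step size is what `IsProximalSequence.tendsto` requires of the constraint map,
whose squared norm is at most `‖A‖² + 1`. -/
theorem convergesGlobally_gpcpmStep [FiniteDimensional ℝ E] [FiniteDimensional ℝ F]
    {A : E →L[ℝ] F} {f : E → EReal} {g : F → EReal} (hf : IsClosedProperConvex f)
    (hg : IsClosedProperConvex g) (hsaddle : ∃ x z y, IsSaddlePoint A f g x z y)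
    {γ lam : ℝ} (hγ : 0 < γ) (hγ2 : γ < 2) (hlam : 0 < lam)
    (hlam' : lam < 1 / √((2 + γ) / 4 * (‖A‖ ^ 2 + 1))) :
    ConvergesGlobally A f g (GPCPMStep A f g γ lam) := by
  have : CompleteSpace E := FiniteDimensional.complete ℝ E
  have : CompleteSpace F := FiniteDimensional.complete ℝ F
  refine ⟨existsUnique_seq_of_existsUnique_step (existsUnique_gpcpmStep hf hg γ hlam),
    fun w hw => ?_⟩
  have hK : 0 < (2 + γ) / 4 * (‖A‖ ^ 2 + 1) := by positivity
  have hsmall : lam ^ 2 * (‖A‖ ^ 2 + 1) < 4 / (2 + γ) := by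
    rw [lt_one_div hlam (Real.sqrt_pos.2 hK), Real.sqrt_lt' (by positivity), one_div, inv_pow,
      ← one_div, lt_div_iff₀ (by positivity)] at hlam'
    rw [lt_div_iff₀ (by positivity)]
    linarith
  have hone : 1 < 4 / (2 + γ) := by
    rw [lt_div_iff₀ (by positivity)]; linarith
  obtain ⟨x₀, z₀, y₀, h₀⟩ := hsaddle
  obtain ⟨u, y, hu, hy, hut, hyt⟩ := (isProximalSequence_of_gpcpmStep hf hg hlam hw).tendsto
    -- the maximum with `1` only serves the normalization `1 ≤ s` of the abstract theorem
    (s := max 1 (lam ^ 2 * (‖A‖ ^ 2 + 1)))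
    (fun u ξ u' ξ' h h' => by
      rw [WithLp.prod_inner_apply]
      exact add_nonneg (h.1.inner_sub_nonneg h'.1) (h.2.inner_sub_nonneg h'.2))
    (fun u ξ u₀ ξ₀ h hu hξ =>
      have hfst := (WithLp.fstL 2 ℝ E F).continuous
      have hsnd := (WithLp.sndL 2 ℝ E F).continuous
      ⟨hf.hasSubgradientAt_of_tendsto (fun k => (h k).1) ((hfst.tendsto _).comp hu)
        ((hfst.tendsto _).comp hξ),
      hg.hasSubgradientAt_of_tendsto (fun k => (h k).2) ((hsnd.tendsto _).comp hu)
        ((hsnd.tendsto _).comp hξ)⟩)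
    hγ hγ2 hlam (le_max_left _ _) (max_lt hone hsmall)
    (fun u => by
      calc lam ^ 2 * ‖constraintMap A u‖ ^ 2
          ≤ lam ^ 2 * ((‖A‖ ^ 2 + 1) * ‖u‖ ^ 2) := by
            gcongr; exact norm_constraintMap_sq_le A u
        _ = lam ^ 2 * (‖A‖ ^ 2 + 1) * ‖u‖ ^ 2 := by ring
        _ ≤ _ := by gcongr; exact le_max_right _ _)
    ⟨WithLp.toLp 2 (x₀, z₀), y₀,
      (isSaddlePoint_iff_prodSubdifferential hf hg (WithLp.toLp 2 (x₀, z₀)) y₀).1 h₀⟩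
  have hs := (isSaddlePoint_iff_prodSubdifferential hf hg u y).2 ⟨hu, hy⟩
  refine ⟨u.fst, u.snd, y, ?_, hs.isSolution hf hg, hs⟩
  exact (((WithLp.fstL 2 ℝ E F).continuous.tendsto u).comp hut).prodMk_nhds
    ((((WithLp.sndL 2 ℝ E F).continuous.tendsto u).comp hut).prodMk_nhds hyt)

theorem gpcpmStep_one (A : E →L[ℝ] F) (f : E → EReal) (g : F → EReal) (lam : ℝ) :
    GPCPMStep A f g 1 lam = PCPMStep A f g lam := by
  ext w w'
  exact ⟨fun h => ⟨h.x_step, h.z_step, by simpa using h.y_step⟩,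
    fun h => ⟨h.x_step, h.z_step, by simpa using h.y_step⟩⟩

end Iteration

end PCPM

theorem mainTheorem2 {n m : ℕ}
    (A : EuclideanSpace ℝ (Fin n) →L[ℝ] EuclideanSpace ℝ (Fin m))
    (f : EuclideanSpace ℝ (Fin n) → EReal) (g : EuclideanSpace ℝ (Fin m) → EReal)
    (hf : PCPM.IsClosedProperConvex f) (hg : PCPM.IsClosedProperConvex g)
    (hsol : ∃ x z, PCPM.IsSolution A f g x z)
    (hfin : ((∀ x, f x ≠ ⊤) ∧ (∀ z, g z ≠ ⊤)) ∨ ∃ x z y, PCPM.IsSaddlePoint A f g x z y) :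
    (∀ γ lam : ℝ, 0 < γ → γ < 2 → 0 < lam →
      lam < 1 / Real.sqrt ((2 + γ) / 4 * (‖A‖ ^ 2 + 1)) →
      PCPM.ConvergesGlobally A f g (PCPM.GPCPMStep A f g γ lam)) ∧
    (∀ lam : ℝ, 0 < lam →
      lam < 1 / Real.sqrt (3 / 4 * (‖A‖ ^ 2 + 1)) →
      PCPM.ConvergesGlobally A f g (PCPM.PCPMStep A f g lam)) := by
  have hsaddle : ∃ x z y, PCPM.IsSaddlePoint A f g x z y := by
    rcases hfin with ⟨hf', hg'⟩ | h
    · obtain ⟨x, z, h⟩ := hsol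
      exact ⟨x, z, h.exists_isSaddlePoint hf hg hf' hg'⟩
    · exact h
  refine ⟨fun γ lam hγ hγ2 hlam hlam' =>
    PCPM.convergesGlobally_gpcpmStep hf hg hsaddle hγ hγ2 hlam hlam', fun lam hlam hlam' => ?_⟩
  rw [← PCPM.gpcpmStep_one]
  refine PCPM.convergesGlobally_gpcpmStep hf hg hsaddle one_pos one_lt_two hlam ?_
  rwa [show ((2 : ℝ) + 1) / 4 = 3 / 4 by norm_num]
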